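/- Let $R$ be a Cohen--Macaulay local (Noetherian) ring with canonical module $\omega$, that is, $\omega$ is a maximal Cohen--Macaulay $R$-module of finite injective dimension such that the natural map $R\to\operatorname{Hom}_R(\omega,\omega)$ is an isomorphism. Assume that $R$ is generically Gorenstein, i.e. that the localization $R_{\mathfrak p}$ is Gorenstein for every minimal prime $\mathfrak p$ of $R$. For $i\ge 0$ let $b_i(\omega)$ denote the $i$-th Betti number of $\omega$, i.e. the rank of the $i$-th free module in a minimal free resolution of $\omega$ over $R$. If $R$ is not Gorenstein, then $b_1(\omega)\ge b_0(\omega)$. -/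

import Mathlib

open IsLocalRing CategoryTheory

universe u v

/-- The depth of a module `M` over a local ring `R`: the supremum of the lengths of the `M`-regular
sequences contained in the maximal ideal. -/
noncomputable def localDepth (R : Type u) [CommRing R] [IsLocalRing R]
    (M : Type v) [AddCommGroup M] [Module R M] : ℕ∞ :=
  ⨆ (rs : List R) (_ : (∀ r ∈ rs, r ∈ maximalIdeal R) ∧ RingTheory.Sequence.IsRegular M rs),
    (rs.length : ℕ∞)

/-- A Cohen--Macaulay local ring: a Noetherian local ring whose depth equals its dimension. -/
class IsCohenMacaulayLocalRing (R : Type u) [CommRing R] : Prop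
    extends IsLocalRing R, IsNoetherianRing R where
  depth_eq_dim : ((localDepth R R : ℕ∞) : WithBot ℕ∞) = ringKrullDim R

/-- A maximal Cohen--Macaulay module over a (Noetherian) local ring `R`: a nonzero finitely
generated module whose depth equals the dimension of `R`. -/
structure IsMaximalCohenMacaulay (R : Type u) [CommRing R] [IsLocalRing R]
    (M : Type v) [AddCommGroup M] [Module R M] : Prop where
  finite : Module.Finite R M
  nontrivial : Nontrivial M
  depth_eq_dim : ((localDepth R M : ℕ∞) : WithBot ℕ∞) = ringKrullDim R

/-- A Gorenstein local ring: a Noetherian local ring of finite injective dimension over itself. -/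
class IsGorensteinLocalRing (R : Type u) [CommRing R] : Prop
    extends IsLocalRing R, IsNoetherianRing R where
  finite_injectiveDimension : ∃ n : ℕ, HasInjectiveDimensionLE (ModuleCat.of R R) n

/-- A ring is generically Gorenstein if its localizations at all minimal primes are Gorenstein. -/
def IsGenericallyGorenstein (R : Type u) [CommRing R] : Prop :=
  ∀ (p : Ideal R) [p.IsPrime], p ∈ minimalPrimes R → IsGorensteinLocalRing (Localization.AtPrime p)

/-- A canonical module `W` of a Cohen--Macaulay local ring `R`: a maximal Cohen--Macaulay module of
finite injective dimension such that the natural map `R → Hom_R(W, W)` is an isomorphism. -/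
structure IsCanonicalModule (R : Type u) [CommRing R] [IsLocalRing R]
    (W : Type v) [AddCommGroup W] [Module R W] : Prop where
  maximalCohenMacaulay : IsMaximalCohenMacaulay R W
  finite_injectiveDimension : ∃ n : ℕ, HasInjectiveDimensionLE (ModuleCat.of R W) n
  bijective_homothety : Function.Bijective (algebraMap R (Module.End R W))

/-- A minimal free resolution
`⋯ ⟶ R ^ rank 2 ⟶ R ^ rank 1 ⟶ R ^ rank 0 ⟶ M ⟶ 0` of a module `M` over a local ring `R`, with
terms of finite rank. The number `rank i` is the `i`-th Betti number of `M`. -/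
structure MinimalFreeResolution (R : Type u) [CommRing R] [IsLocalRing R]
    (M : Type v) [AddCommGroup M] [Module R M] where
  /-- the rank of the `i`-th free module -/
  rank : ℕ → ℕ
  /-- the differential from degree `i + 1` to degree `i` -/
  d : ∀ i : ℕ, (Fin (rank (i + 1)) → R) →ₗ[R] (Fin (rank i) → R)
  /-- the augmentation -/
  ε : (Fin (rank 0) → R) →ₗ[R] M
  surjective_ε : Function.Surjective ε
  exact_zero : Function.Exact (d 0) ε
  exact_succ : ∀ i : ℕ, Function.Exact (d (i + 1)) (d i)
  /-- minimality: the image of `d i` lies in `𝔪 R ^ rank i`, i.e. all coordinates lie in `𝔪` -/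
  minimal : ∀ (i : ℕ) (x : Fin (rank (i + 1)) → R) (j : Fin (rank i)), d i x j ∈ maximalIdeal R

/-- Every finitely generated module over a local ring has a minimal free cover. -/
theorem exists_minimal_free_cover (R : Type u) [CommRing R] [IsLocalRing R]
    (M : Type v) [AddCommGroup M] [Module R M] [Module.Finite R M] :
    ∃ (n : ℕ) (f : (Fin n → R) →ₗ[R] M), Function.Surjective f ∧
      ∀ x ∈ LinearMap.ker f, ∀ j, x j ∈ maximalIdeal R := by
  classical
  have hex : ∃ n : ℕ, ∃ f : (Fin n → R) →ₗ[R] M, Function.Surjective f :=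
    Module.Finite.exists_fin' R M
  obtain ⟨f, hf⟩ := Nat.find_spec hex
  have hmin : ∀ m, m < Nat.find hex → ¬ ∃ g : (Fin m → R) →ₗ[R] M, Function.Surjective g :=
    fun m hm => Nat.find_min hex hm
  revert f hmin
  generalize Nat.find hex = n
  intro f hf hmin
  refine ⟨n, f, hf, fun x hx j => ?_⟩
  by_contra hj
  have hu : IsUnit (x j) := by simpa [mem_maximalIdeal, mem_nonunits_iff] using hj
  obtain ⟨u, hu⟩ := hu
  cases n with
  | zero => exact j.elim0
  | succ m =>
    refine hmin m (Nat.lt_succ_self m) ⟨f ∘ₗ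
      { toFun := fun y => j.insertNth (α := fun _ => R) 0 y
        map_add' := fun y z => by
          ext k; refine Fin.succAboveCases j ?_ (fun k => ?_) k <;> simp
        map_smul' := fun c y => by
          ext k; refine Fin.succAboveCases j ?_ (fun k => ?_) k <;> simp }, fun w => ?_⟩
    obtain ⟨y, rfl⟩ := hf w
    refine ⟨fun k => y (j.succAbove k) - y j * ↑u⁻¹ * x (j.succAbove k), ?_⟩
    have key : (j.insertNth (α := fun _ => R) 0
        (fun k => y (j.succAbove k) - y j * ↑u⁻¹ * x (j.succAbove k))) =
        y - (y j * (↑u⁻¹ : R)) • x := by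
      ext k
      refine Fin.succAboveCases j ?_ (fun k => ?_) k
      · simp [← hu, mul_assoc]
      · simp
    have hx' : f x = 0 := hx
    simp [key, hx']

/-- Every finitely generated module over a Noetherian local ring has a minimal free resolution. -/
theorem MinimalFreeResolution.nonempty (R : Type u) [CommRing R] [IsLocalRing R]
    [IsNoetherianRing R] (M : Type v) [AddCommGroup M] [Module R M] [Module.Finite R M] :
    Nonempty (MinimalFreeResolution R M) := by
  obtain ⟨n, f, hf, hm⟩ := exists_minimal_free_cover R M
  have step : ∀ s : (Σ n : ℕ, Submodule R (Fin n → R)), ∃ (m : ℕ) (g : (Fin m → R) →ₗ[R] s.2),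
      Function.Surjective g ∧ ∀ x ∈ LinearMap.ker g, ∀ j, x j ∈ maximalIdeal R :=
    fun s => exists_minimal_free_cover R s.2
  choose m g hg hgm using step
  let S : ℕ → (Σ n : ℕ, Submodule R (Fin n → R)) :=
    fun i => Nat.rec ⟨n, LinearMap.ker f⟩ (fun _ s => ⟨m s, LinearMap.ker (g s)⟩) i
  have hS : ∀ i, ∀ x ∈ (S i).2, ∀ j, x j ∈ maximalIdeal R := by
    intro i
    cases i with
    | zero => exact hm
    | succ i => exact hgm (S i)
  exact ⟨{
    rank := fun i => (S i).1
    d := fun i => (S i).2.subtype ∘ₗ g (S i)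
    ε := f
    surjective_ε := hf
    exact_zero := fun y => by
      constructor
      · intro hy
        obtain ⟨x, hx⟩ := hg (S 0) ⟨y, hy⟩
        exact ⟨x, congrArg Subtype.val hx⟩
      · rintro ⟨x, rfl⟩
        exact (g (S 0) x).2
    exact_succ := fun i y => by
      constructor
      · intro hy
        have hy' : y ∈ (S (i + 1)).2 := Subtype.ext hy
        obtain ⟨x, hx⟩ := hg (S (i + 1)) ⟨y, hy'⟩
        exact ⟨x, congrArg Subtype.val hx⟩
      · rintro ⟨x, rfl⟩
        have h : g (S i) (g (S (i + 1)) x).1 = 0 := (g (S (i + 1)) x).2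
        exact congrArg Subtype.val h
    minimal := fun i x j => hS i _ (g (S i) x).2 j }⟩

/-! Suppose `b₁ < b₀` and consider `R ^ b₁ → R ^ b₀ → ω → 0`. At a minimal prime `p` the ring `R_p`
is Artinian and self-injective, so the faithful module `ω_p` has `R_p` as a summand; its
endomorphisms being homotheties, `ω_p ≅ R_p`. Counting lengths, the kernel of `d_p` has length `(b₁
+ 1 - b₀) ℓ(R_p) ≤ 0`, so `d_p` is injective. Since `Ass R = Min R`, `d` itself is injective
(`injective_of_isGenericallyGorenstein`). If `b₁ ≠ 0`, put `n = depth R = depth ω`. By minimality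
`d` induces zero on `Ext^n(k, -)`, while `Ext^(n-1)(k, ω) = 0` makes this map injective; hence
`Ext^n(k, R) = 0` and `depth R > n`, absurd (`exists_isRegular_of_injective_of_minimal`). So `b₁ =
0`, `ω` is free and nonzero, and its summand `R` has finite injective dimension: `R` is Gorenstein.
-/

/-! ### Depth and associated primes -/

open Pointwise in
/-- The length of a regular sequence bounds the coheight of every associated prime from below. -/
theorem length_le_coheight_of_isAssociatedPrime {R : Type u} [CommRing R] [IsLocalRing R]
    [IsNoetherianRing R] (rs : List R) : ∀ {M : Type v} [AddCommGroup M] [Module R M]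
    [Module.Finite R M], (∀ r ∈ rs, r ∈ maximalIdeal R) → RingTheory.Sequence.IsRegular M rs →
    ∀ p : PrimeSpectrum R, IsAssociatedPrime p.asIdeal M → (rs.length : ℕ∞) ≤ Order.coheight p := by
  induction rs with
  | nil => simp
  | cons x rs ih =>
    intro M _ _ _ hm hreg p hp
    obtain ⟨hx, hrs⟩ := (RingTheory.Sequence.isRegular_cons_iff M x rs).mp hreg
    obtain ⟨hpp, m, hpm⟩ := (isAssociatedPrime_iff).mp hp
    have memp (a : R) : a ∈ p.asIdeal ↔ a • m = 0 := by
      rw [hpm, Submodule.mem_colon_singleton, Submodule.mem_bot]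
    have hm0 : m ≠ 0 := fun h =>
      hpp.ne_top ((Ideal.eq_top_iff_one _).mpr ((memp 1).mpr (by simp [h])))
    let N : Submodule R M := Submodule.torsionBySet R M p.asIdeal
    have memN (z : M) : z ∈ N ↔ ∀ a ∈ p.asIdeal, a • z = 0 := by
      simp [N, Submodule.mem_torsionBySet_iff]
    have hxm : x ∈ maximalIdeal R := hm x (by simp)
    -- If `N ⊆ xM`, regularity of `x` gives `N = xN`, and Nakayama forces `N = 0`, although `m ∈ N`.
    -- The class of `z` in `M/xM` is then nonzero and killed by `p` and `x`.
    obtain ⟨z, hzN, hz⟩ : ∃ z ∈ N, z ∉ x • (⊤ : Submodule R M) := by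
      by_contra! hcon
      have hle : N ≤ maximalIdeal R • N := by
        intro z hz
        obtain ⟨w, -, hw⟩ := (Submodule.mem_smul_pointwise_iff_exists _ _ _).mp (hcon z hz)
        have hwN : w ∈ N := by
          rw [memN] at hz ⊢
          intro a ha
          have := hz a ha
          rw [← hw, smul_comm] at this
          exact hx.right_eq_zero_of_smul this
        rw [← hw]
        exact Submodule.smul_mem_smul hxm hwN
      have hbot : N = ⊥ := Submodule.eq_bot_of_le_smul_of_le_jacobson_bot _ N
        (IsNoetherian.noetherian N) hle (maximalIdeal_le_jacobson _)
      exact hm0 ((Submodule.mem_bot R).mp (hbot ▸ (memN m).mpr fun a ha => (memp a).mp ha))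
    let y : QuotSMulTop x M := Submodule.Quotient.mk z
    have hy : y ≠ 0 := fun h => hz ((Submodule.Quotient.mk_eq_zero _).mp h)
    obtain ⟨P, hP, hle⟩ := exists_le_isAssociatedPrime_of_isNoetherianRing R y hy
    have hmem (a : R) (ha : a • y = 0) : a ∈ P := hle (by
      rw [Submodule.mem_colon_singleton, ha]; exact Submodule.zero_mem _)
    have hpP : p.asIdeal ≤ P := fun a ha => hmem a (by
      change Submodule.Quotient.mk (a • z) = _
      rw [(memN z).mp hzN a ha]; rfl)
    have hxP : x ∈ P := hmem x ((Submodule.Quotient.mk_eq_zero _).mpr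
      (Submodule.smul_mem_pointwise_smul z x ⊤ trivial))
    have hlt : p < ⟨P, hP.isPrime⟩ := by
      refine lt_of_le_of_ne hpP fun h => ?_
      have : x ∈ p.asIdeal := by rw [h]; exact hxP
      exact hm0 (hx.right_eq_zero_of_smul ((memp x).mp this))
    have := ih (M := QuotSMulTop x M) (fun r hr => hm r (by simp [hr])) hrs ⟨P, hP.isPrime⟩ hP
    rw [List.length_cons, Nat.cast_succ]
    exact (add_le_add_left this 1).trans (Order.coheight_add_one_le hlt)

/-- A finite depth is attained by a regular sequence. -/
theorem exists_isRegular_of_localDepth_eq {R : Type u} [CommRing R] [IsLocalRing R]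
    {M : Type v} [AddCommGroup M] [Module R M] [Nontrivial M] {n : ℕ} (h : localDepth R M = n) :
    ∃ rs : List R, rs.length = n ∧ (∀ r ∈ rs, r ∈ maximalIdeal R) ∧
      RingTheory.Sequence.IsRegular M rs := by
  by_contra! hcon
  obtain _ | n := n
  · exact hcon [] rfl (by simp) (RingTheory.Sequence.IsRegular.nil R M)
  · have : localDepth R M ≤ n := by
      refine iSup₂_le fun rs hrs => ?_
      have h1 : (rs.length : ℕ∞) ≤ localDepth R M :=
        le_iSup₂ (f := fun (rs : List R) (_ : (∀ r ∈ rs, r ∈ maximalIdeal R) ∧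
          RingTheory.Sequence.IsRegular M rs) => (rs.length : ℕ∞)) rs hrs
      rw [h] at h1
      have h2 : rs.length ≠ n + 1 := fun h => hcon rs h hrs.1 hrs.2
      norm_cast at h1 ⊢
      omega
    rw [h] at this
    norm_cast at this
    omega

theorem length_le_localDepth {R : Type u} [CommRing R] [IsLocalRing R]
    {M : Type v} [AddCommGroup M] [Module R M] {rs : List R} (h : ∀ r ∈ rs, r ∈ maximalIdeal R)
    (hreg : RingTheory.Sequence.IsRegular M rs) : (rs.length : ℕ∞) ≤ localDepth R M :=
  le_iSup₂ (f := fun (rs : List R) (_ : (∀ r ∈ rs, r ∈ maximalIdeal R) ∧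
    RingTheory.Sequence.IsRegular M rs) => (rs.length : ℕ∞)) rs ⟨h, hreg⟩

theorem IsCohenMacaulayLocalRing.exists_localDepth_eq (R : Type u) [CommRing R]
    [IsCohenMacaulayLocalRing R] : ∃ n : ℕ, localDepth R R = n ∧ ringKrullDim R = n := by
  have h := IsCohenMacaulayLocalRing.depth_eq_dim (R := R)
  obtain ⟨n, hn⟩ := ENat.ne_top_iff_exists.mp (show localDepth R R ≠ ⊤ by
    intro htop
    rw [htop] at h
    exact (ringKrullDim_lt_top (R := R)).ne h.symm)
  exact ⟨n, hn.symm, by rw [← h, ← hn]; rfl⟩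

/-- A Cohen--Macaulay local ring has no embedded primes. -/
theorem IsCohenMacaulayLocalRing.mem_minimalPrimes {R : Type u} [CommRing R]
    [IsCohenMacaulayLocalRing R] {p : Ideal R} (hp : IsAssociatedPrime p R) :
    p ∈ minimalPrimes R := by
  obtain ⟨n, hn, hdim⟩ := exists_localDepth_eq R
  obtain ⟨rs, hlen, hm, hreg⟩ := exists_isRegular_of_localDepth_eq hn
  have := hp.isPrime
  let P : PrimeSpectrum R := ⟨p, this⟩
  have h1 := length_le_coheight_of_isAssociatedPrime rs hm hreg P hp
  -- Height plus coheight is at most `dim R = n`, and the coheight is already at least `n`.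
  have h2 : ((Order.height P + Order.coheight P : ℕ∞) : WithBot ℕ∞) ≤ ringKrullDim R := by
    rw [ringKrullDim, Order.krullDim_eq_iSup_height_add_coheight_of_nonempty]
    exact WithBot.coe_le_coe.mpr (le_iSup (fun a => Order.height a + Order.coheight a) P)
  rw [hdim] at h2
  have h3 : Order.height P + Order.coheight P ≤ n := WithBot.coe_le_coe.mp h2
  rw [← Ideal.height_eq_zero_iff,
    show p.height = Order.height P from PrimeSpectrum.height_eq_orderHeight P]
  rw [hlen] at h1
  have h4 : Order.height P + n ≤ 0 + n := by
    rw [zero_add]; exact (add_le_add_right h1 _).trans h3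
  exact le_antisymm ((ENat.add_le_add_iff_right (ENat.natCast_ne_top n)).mp h4) bot_le

/-! ### Self-injectivity at the minimal primes -/

/-- A zero-dimensional Noetherian local ring of finite injective dimension over itself is
self-injective. -/
theorem baer_self_of_hasInjectiveDimensionLE {A : Type u} [CommRing A] [IsLocalRing A]
    [IsNoetherianRing A] [Ring.KrullDimLE 0 A] {n : ℕ}
    (h : HasInjectiveDimensionLE (ModuleCat.of A A) n) : Module.Baer A A := by
  have hmax (p : Ideal A) (hp : p.IsPrime) : p = maximalIdeal A :=
    eq_maximalIdeal hp.isMaximal'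
  -- Dimension shifting downwards, by prime filtration. The only prime is the maximal ideal, and the
  -- residue field `k` embeds in `A`; so `Ext^(i+1)(k, A)` lies between `Ext^(i+1)(A, A) = 0` and
  -- `Ext^(i+2)(A/k, A) = 0`.
  have step (i : ℕ) (hi : ∀ N : ModuleCat.{u} A, Module.Finite A N →
      Subsingleton (Abelian.Ext N (ModuleCat.of A A) (i + 2))) :
      ∀ N : ModuleCat.{u} A, Module.Finite A N →
        Subsingleton (Abelian.Ext N (ModuleCat.of A A) (i + 1)) := by
    intro N hN
    let motive : (N : Type u) → [AddCommGroup N] → [Module A N] → [Module.Finite A N] → Prop :=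
      fun N _ _ _ => Subsingleton (Abelian.Ext (ModuleCat.of A N) (ModuleCat.of A A) (i + 1))
    refine IsNoetherianRing.induction_on_isQuotientEquivQuotientPrime A (M := N) hN
      (motive := motive) ?_ ?_ ?_
    · intro N _ _ _ _
      refine ⟨fun x y => ?_⟩
      have hid : 𝟙 (ModuleCat.of A N) = 0 := by ext; exact Subsingleton.elim _ _
      rw [← Abelian.Ext.mk₀_id_comp x, ← Abelian.Ext.mk₀_id_comp y, hid]
      simp
    · intro N _ _ _ p e
      obtain ⟨q, hq⟩ := associatedPrimes.nonempty A A
      obtain ⟨hqp, f, hf⟩ := (isAssociatedPrime_iff_exists_injective_linearMap q A).mp hq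
      have hpq : p.1 = q := (hmax _ p.2).trans (hmax _ hqp).symm
      subst hpq
      let g : N →ₗ[A] A := f ∘ₗ e.toLinearMap
      have hg : Function.Injective g := hf.comp e.injective
      let S := ModuleCat.shortComplexOfCompEqZero _ _ g.exact_map_mkQ_range.linearMap_comp_eq_zero
      have hS : S.ShortExact := ModuleCat.shortComplex_shortExact S g.exact_map_mkQ_range hg
        (Submodule.mkQ_surjective _)
      refine ⟨fun x y => ?_⟩
      suffices ∀ x : Abelian.Ext S.X₁ (ModuleCat.of A A) (i + 1), x = 0 from
        (this x).trans (this y).symm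
      intro x
      have : Subsingleton (Abelian.Ext S.X₃ (ModuleCat.of A A) (i + 2)) :=
        hi S.X₃ (inferInstanceAs (Module.Finite A (A ⧸ LinearMap.range g)))
      obtain ⟨y, rfl⟩ := Abelian.Ext.contravariant_sequence_exact₁ hS _ x
        (show 1 + (i + 1) = i + 2 by omega) (Subsingleton.elim _ _)
      have hproj : Projective S.X₂ := inferInstanceAs (Projective (ModuleCat.of A A))
      have hy : y = 0 := Abelian.Ext.eq_zero_of_projective y
      simp [hy]
    · intro N₁ _ _ _ N₂ _ _ _ N₃ _ _ _ f g hf hg hfg h₁ h₃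
      let S := ModuleCat.shortComplexOfCompEqZero f g hfg.linearMap_comp_eq_zero
      have hS : S.ShortExact := ModuleCat.shortComplex_shortExact S hfg hf hg
      refine ⟨fun x y => ?_⟩
      suffices ∀ x : Abelian.Ext S.X₂ (ModuleCat.of A A) (i + 1), x = 0 from
        (this x).trans (this y).symm
      intro x
      have h₁' : Subsingleton (Abelian.Ext S.X₁ (ModuleCat.of A A) (i + 1)) := h₁
      have h₃' : Subsingleton (Abelian.Ext S.X₃ (ModuleCat.of A A) (i + 1)) := h₃
      obtain ⟨y, rfl⟩ := Abelian.Ext.contravariant_sequence_exact₂ hS _ x (Subsingleton.elim _ _)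
      rw [Subsingleton.elim y 0, Abelian.Ext.comp_zero]
  have vanish (j : ℕ) : (∀ N : ModuleCat.{u} A, Module.Finite A N →
      Subsingleton (Abelian.Ext N (ModuleCat.of A A) (j + 1))) →
      ∀ N : ModuleCat.{u} A, Module.Finite A N →
        Subsingleton (Abelian.Ext N (ModuleCat.of A A) 1) := by
    induction j with
    | zero => exact id
    | succ j ih => exact fun h => ih (step j h)
  have hone := vanish n fun N _ => HasInjectiveDimensionLT.subsingleton _ (n + 1) (n + 1) le_rfl N
  intro I g
  let S := ModuleCat.shortComplexOfCompEqZero _ _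
    (LinearMap.exact_subtype_mkQ I).linearMap_comp_eq_zero
  have hS : S.ShortExact := ModuleCat.shortComplex_shortExact S (LinearMap.exact_subtype_mkQ I)
    I.injective_subtype (Submodule.mkQ_surjective _)
  have : Subsingleton (Abelian.Ext S.X₃ (ModuleCat.of A A) 1) :=
    hone S.X₃ (inferInstanceAs (Module.Finite A (A ⧸ I)))
  obtain ⟨φ, hφ⟩ := Abelian.Ext.contravariant_sequence_exact₁ hS (ModuleCat.of A A)
    (Abelian.Ext.mk₀ (ModuleCat.ofHom g : S.X₁ ⟶ ModuleCat.of A A)) (zero_add 1)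
    (Subsingleton.elim _ _)
  obtain ⟨φ, rfl⟩ := (Abelian.Ext.mk₀_bijective _ _).2 φ
  rw [Abelian.Ext.mk₀_comp_mk₀, (Abelian.Ext.mk₀_bijective _ _).1.eq_iff] at hφ
  exact ⟨φ.hom, fun x hx => congr($hφ ⟨x, hx⟩)⟩

/-- A finite faithful module over a self-injective local ring has the ring as a direct summand. -/
theorem exists_retraction_of_faithful {A : Type u} [CommRing A] [IsLocalRing A]
    (hA : Module.Baer A A) {N : Type v} [AddCommGroup N] [Module A N] [Module.Finite A N]
    (hN : ∀ a : A, (∀ x : N, a • x = 0) → a = 0) :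
    ∃ (i : A →ₗ[A] N) (π : N →ₗ[A] A), π ∘ₗ i = LinearMap.id := by
  obtain ⟨n, s, hs⟩ := Module.Finite.exists_fin (R := A) (M := N)
  let f : A →ₗ[A] (Fin n → N) := LinearMap.pi fun j => LinearMap.toSpanSingleton A N (s j)
  have hf : Function.Injective f := by
    rw [injective_iff_map_eq_zero]
    intro a ha
    refine hN a fun x => ?_
    have hx : x ∈ Submodule.span A (Set.range s) := hs ▸ trivial
    induction hx using Submodule.span_induction with
    | mem x hx =>
      obtain ⟨j, rfl⟩ := hx
      simpa [f] using congrFun ha j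
    | zero => simp
    | add x y _ _ hx hy => rw [smul_add, hx, hy, add_zero]
    | smul b x _ hx => rw [smul_comm, hx, smul_zero]
  obtain ⟨h, hh⟩ := hA.extension_property f hf LinearMap.id
  -- The retraction `h` of `a ↦ (a • s j)_j` writes `1` as a sum over the generators; in a local
  -- ring some summand is a unit, and that generator spans a free summand.
  have hsum : ∑ j, h (Pi.single j (s j)) = 1 := by
    rw [← map_sum, Finset.univ_sum_single]
    have hs1 : f 1 = s := funext fun j => by simp [f]
    rw [← hs1]
    exact LinearMap.congr_fun hh 1
  have hunit : ∃ j, IsUnit (h (Pi.single j (s j))) := by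
    by_contra! hcon
    have : (1 : A) ∈ maximalIdeal A := hsum ▸ Ideal.sum_mem _ fun j _ => hcon j
    exact this isUnit_one
  obtain ⟨j, u, hu⟩ := hunit
  refine ⟨LinearMap.toSpanSingleton A N (s j), (↑u⁻¹ : A) • (h ∘ₗ LinearMap.single A _ j), ?_⟩
  ext
  simp [← hu]

/-! ### Minimal maps and vanishing of Ext -/

/-- By linearity of Ext a scalar `r ∈ I` moves from the map `1 ↦ r • y` onto `x`, where it acts
through `K` and so vanishes. -/
theorem Ext.comp_mk₀_toSpanSingleton_eq_zero {R : Type u} [CommRing R] {K : ModuleCat.{u} R}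
    {I : Ideal R} (hI : I ≤ Module.annihilator R K) {N : ModuleCat.{u} R} {n : ℕ}
    (x : Abelian.Ext K (ModuleCat.of R R) n) {z : N} (hz : z ∈ I • (⊤ : Submodule R N)) :
    x.comp (Abelian.Ext.mk₀ (ModuleCat.ofHom (LinearMap.toSpanSingleton R N z)))
      (add_zero n) = 0 := by
  induction hz using Submodule.smul_induction_on' with
  | smul r hr y _ =>
    have h1 : r • x = 0 := by
      have h2 : r • 𝟙 K = 0 := by
        ext k
        exact Module.mem_annihilator.mp (hI hr) k
      rw [← Abelian.Ext.mk₀_id_comp x, ← Abelian.Ext.smul_comp, ← Abelian.Ext.mk₀_smul, h2]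
      simp
    have h3 : ModuleCat.ofHom (LinearMap.toSpanSingleton R N (r • y)) =
        r • ModuleCat.ofHom (LinearMap.toSpanSingleton R N y) := by
      ext; simp
    rw [h3, Abelian.Ext.mk₀_smul, Abelian.Ext.comp_smul, ← Abelian.Ext.smul_comp, h1,
      Abelian.Ext.zero_comp]
  | add y _ z _ hy hz =>
    have h3 : ModuleCat.ofHom (LinearMap.toSpanSingleton R N (y + z)) =
        ModuleCat.ofHom (LinearMap.toSpanSingleton R N y) +
        ModuleCat.ofHom (LinearMap.toSpanSingleton R N z) := by
      ext; simp
    rw [h3, Abelian.Ext.mk₀_add, Abelian.Ext.comp_add, hy, hz, add_zero]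

/-- If `R` is a direct summand of the first term of a short exact sequence whose first map sends it
into `I` times the second term, and `I` kills `K`, then vanishing of `Ext K · i` on the third term
for `i < n` forces `Ext K R n = 0`. -/
theorem Ext.subsingleton_of_shortExact {R : Type u} [CommRing R] {K : ModuleCat.{u} R}
    {I : Ideal R} (hI : I ≤ Module.annihilator R K) {S : ShortComplex (ModuleCat.{u} R)}
    (hS : S.ShortExact) (e : ModuleCat.of R R ⟶ S.X₁) (π : S.X₁ ⟶ ModuleCat.of R R)
    (heπ : e ≫ π = 𝟙 _) {z : S.X₂} (hz : z ∈ I • (⊤ : Submodule R S.X₂))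
    (hez : e ≫ S.f = ModuleCat.ofHom (LinearMap.toSpanSingleton R S.X₂ z)) (n : ℕ)
    (hn : ∀ i < n, Subsingleton (Abelian.Ext K S.X₃ i)) :
    Subsingleton (Abelian.Ext K (ModuleCat.of R R) n) := by
  suffices ∀ x : Abelian.Ext K (ModuleCat.of R R) n, x = 0 from
    ⟨fun x y => (this x).trans (this y).symm⟩
  intro x
  have hx : (x.comp (Abelian.Ext.mk₀ e) (add_zero _)).comp (Abelian.Ext.mk₀ S.f)
      (add_zero _) = 0 := by
    rw [Abelian.Ext.comp_assoc_of_third_deg_zero, Abelian.Ext.mk₀_comp_mk₀, hez]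
    exact Ext.comp_mk₀_toSpanSingleton_eq_zero hI x hz
  -- In positive degree the class comes from `Ext^(n-1)(K, X₃) = 0`; in degree zero `S.f` is mono.
  -- The retraction `π` then removes `e`.
  have hxe : x.comp (Abelian.Ext.mk₀ e) (add_zero _) = 0 := by
    obtain _ | n := n
    · have := hS.mono_f
      exact (injective_iff_map_eq_zero _).mp
        (Abelian.Ext.postcomp_mk₀_injective_of_mono K S.f) _ hx
    · obtain ⟨w, hw⟩ := Abelian.Ext.covariant_sequence_exact₁ K hS _ hx rfl
      have := hn n (Nat.lt_succ_self n)
      rw [← hw, Subsingleton.elim w 0, Abelian.Ext.zero_comp]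
  rw [← Abelian.Ext.comp_mk₀_id x, ← heπ, ← Abelian.Ext.mk₀_comp_mk₀,
    ← Abelian.Ext.comp_assoc_of_third_deg_zero, hxe, Abelian.Ext.zero_comp]

/-- If the cokernel of an injective minimal map of free modules has a regular sequence of length
`n` and the source is nonzero, then the ring has a regular sequence of length `n + 1`. -/
theorem exists_isRegular_of_injective_of_minimal {R : Type u} [CommRing R] [IsLocalRing R]
    [IsNoetherianRing R] {b c : ℕ} (hb : b ≠ 0) (d : (Fin b → R) →ₗ[R] (Fin c → R))
    (hd : Function.Injective d) (hmin : ∀ x j, d x j ∈ maximalIdeal R) {rs : List R}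
    (hm : ∀ r ∈ rs, r ∈ maximalIdeal R)
    (hreg : RingTheory.Sequence.IsRegular ((Fin c → R) ⧸ LinearMap.range d) rs) (ts : List R)
    (hmt : ∀ r ∈ ts, r ∈ maximalIdeal R) (hts : RingTheory.Sequence.IsRegular R ts)
    (hlen : ts.length = rs.length) :
    ∃ qs : List R, qs.length = rs.length + 1 ∧ (∀ r ∈ qs, r ∈ maximalIdeal R) ∧
      RingTheory.Sequence.IsRegular R qs := by
  let K : ModuleCat.{u} R := ModuleCat.of R (R ⧸ maximalIdeal R)
  have hsupp : Module.support R K = PrimeSpectrum.zeroLocus (maximalIdeal R) := by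
    rw [Module.support_eq_zeroLocus]
    exact congrArg (fun I : Ideal R => PrimeSpectrum.zeroLocus (I : Set R))
      (Ideal.annihilator_quotient)
  have lt (M : ModuleCat.{u} R) [Module.Finite R M] [Nontrivial M] :
      maximalIdeal R • (⊤ : Submodule R M) < ⊤ :=
    (Ne.lt_top' (Submodule.top_ne_ideal_smul_of_le_jacobson_annihilator
      (maximalIdeal_le_jacobson _)))
  have hntW : Nontrivial ((Fin c → R) ⧸ LinearMap.range d) := hreg.nontrivial
  let S := ModuleCat.shortComplexOfCompEqZero _ _ d.exact_map_mkQ_range.linearMap_comp_eq_zero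
  have hS : S.ShortExact := ModuleCat.shortComplex_shortExact S d.exact_map_mkQ_range hd
    (Submodule.mkQ_surjective _)
  have hW : ∀ i < rs.length, Subsingleton (Abelian.Ext K S.X₃ i) :=
    ModuleCat.subsingleton_ext_of_exists_isRegular (maximalIdeal R) K hsupp.subset
      (ModuleCat.of R ((Fin c → R) ⧸ LinearMap.range d)) (lt _) rs hm hreg
  have hR : ∀ i < ts.length, Subsingleton (Abelian.Ext K (ModuleCat.of R R) i) :=
    ModuleCat.subsingleton_ext_of_exists_isRegular (maximalIdeal R) K hsupp.subset
      (ModuleCat.of R R) (lt _) ts hmt hts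
  refine ModuleCat.exists_isRegular_of_exists_subsingleton_ext (maximalIdeal R) (rs.length + 1)
    (ModuleCat.of R R) (lt _) K hsupp fun i hi => ?_
  -- Degrees below the length are covered by `ts`; only the top degree needs the short exact
  -- sequence.
  obtain hi | rfl := Nat.lt_succ_iff_lt_or_eq.mp hi
  · exact hR i (hlen ▸ hi)
  let j : Fin b := ⟨0, Nat.pos_of_ne_zero hb⟩
  have hz : d (Pi.single j 1) ∈ maximalIdeal R • (⊤ : Submodule R (Fin c → R)) := by
    rw [pi_eq_sum_univ (d (Pi.single j 1))]
    exact Submodule.sum_mem _ fun k _ => Submodule.smul_mem_smul (hmin _ k) trivial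
  refine Ext.subsingleton_of_shortExact (Ideal.annihilator_quotient).ge hS
    (ModuleCat.ofHom (LinearMap.single R (fun _ => R) j)) (ModuleCat.ofHom (LinearMap.proj j))
    ?_ hz ?_ rs.length hW
  · rw [← ModuleCat.ofHom_comp, LinearMap.proj_comp_single_same]
    rfl
  · refine ModuleCat.hom_ext (LinearMap.ext_ring ?_)
    change d (Pi.single j 1) = (1 : R) • d (Pi.single j 1)
    rw [one_smul]

/-! ### Localization at minimal primes -/

theorem Localization.AtPrime.krullDimLE_zero {R : Type u} [CommRing R] {p : Ideal R} [p.IsPrime]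
    (hp : p ∈ minimalPrimes R) : Ring.KrullDimLE 0 (Localization.AtPrime p) := by
  have h := IsLocalization.AtPrime.ringKrullDim_eq_height p (Localization.AtPrime p)
  rw [Ideal.height_eq_zero_iff.mpr hp] at h
  exact (Order.krullDimLE_iff _ _).mpr h.le

/-- If `W` is a finite module whose endomorphisms are the homotheties and `R` localizes at `p` to a
self-injective ring, then `W` is free of rank one at `p`. -/
theorem nonempty_localizedModule_equiv_of_baer {R : Type u} [CommRing R] [IsNoetherianRing R]
    {p : Ideal R} [p.IsPrime] (hA : Module.Baer (Localization.AtPrime p) (Localization.AtPrime p))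
    {W : Type v} [AddCommGroup W] [Module R W] [Module.Finite R W]
    (hW : Function.Bijective (algebraMap R (Module.End R W))) :
    Nonempty (LocalizedModule p.primeCompl W ≃ₗ[Localization.AtPrime p]
      Localization.AtPrime p) := by
  let S := p.primeCompl
  have hfp : Module.FinitePresentation R W := Module.finitePresentation_of_finite R W
  let ι := LocalizedModule.mkLinearMap S W
  have tower (r : R) (s : S) (x : LocalizedModule S W)
      (h : (IsLocalization.mk' (Localization.AtPrime p) r s) • x = 0) : r • x = 0 := by
    rw [← IsScalarTower.algebraMap_smul (Localization.AtPrime p) r x,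
      ← IsLocalization.mk'_spec' (Localization.AtPrime p) r s, mul_smul, h, smul_zero]
  have hfaith (a : Localization.AtPrime p) (ha : ∀ x : LocalizedModule S W, a • x = 0) :
      a = 0 := by
    obtain ⟨r, s, rfl⟩ := IsLocalization.exists_mk'_eq S a
    -- As `W` is finitely presented, `Hom` commutes with localization: if `r` is zero on `W_p`, some
    -- `t ∉ p` makes `t * r` zero on `W`, hence zero in `R`.
    have h0 : IsLocalizedModule.map S ι ι (algebraMap R (Module.End R W) r) =
        IsLocalizedModule.map S ι ι 0 := by
      refine IsLocalizedModule.ext S ι (IsLocalizedModule.map_units ι) ?_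
      ext x
      simpa [IsLocalizedModule.map_apply] using! tower r s (ι x) (ha _)
    obtain ⟨t, ht⟩ := IsLocalizedModule.exists_of_eq (S := S) (f := IsLocalizedModule.map S ι ι) h0
    rw [IsLocalization.mk'_eq_zero_iff]
    refine ⟨t, hW.1 ?_⟩
    rw [map_mul, map_zero]
    ext x
    have h1 : (t : R) • r • x = (t : R) • (0 : W) := LinearMap.congr_fun ht x
    change (t : R) • r • x = 0
    rw [h1, smul_zero]
  obtain ⟨i, π, hπ⟩ := exists_retraction_of_faithful hA hfaith
  have hπi (a : Localization.AtPrime p) : π (i a) = a := LinearMap.congr_fun hπ a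
  -- The projection onto the complement of the free summand is a homothety `r / s`. It kills `i 1`,
  -- so `r = 0` in `R_p` and the complement vanishes.
  let φ : LocalizedModule S W →ₗ[Localization.AtPrime p] LocalizedModule S W :=
    LinearMap.id - i ∘ₗ π
  have hφi (a : Localization.AtPrime p) : φ (i a) = 0 := by simp [φ, hπi]
  obtain ⟨⟨f, s⟩, hf⟩ := IsLocalizedModule.surj S (IsLocalizedModule.map S ι ι)
    (φ.restrictScalars R)
  obtain ⟨r, rfl⟩ := hW.2 f
  have hscalar : IsLocalizedModule.map S ι ι (algebraMap R (Module.End R W) r) =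
      algebraMap R (Module.End R (LocalizedModule S W)) r := by
    refine IsLocalizedModule.ext S ι (IsLocalizedModule.map_units ι) ?_
    ext x
    simp [IsLocalizedModule.map_apply]
  rw [hscalar] at hf
  have hφ (x : LocalizedModule S W) : s • φ x = r • x := LinearMap.congr_fun hf x
  have hr : algebraMap R (Localization.AtPrime p) r = 0 := by
    have h1 := hφ (i 1)
    rw [hφi, smul_zero] at h1
    rw [← hπi (algebraMap R (Localization.AtPrime p) r), Algebra.algebraMap_eq_smul_one,
      i.map_smul_of_tower, ← h1, map_zero]
  have hφ0 (x : LocalizedModule S W) : i (π x) = x := by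
    have h1 := hφ x
    rw [← IsScalarTower.algebraMap_smul (Localization.AtPrime p) r x, hr, zero_smul] at h1
    have h2 : φ x = 0 := IsLocalizedModule.smul_injective ι s (by simpa using h1)
    exact (sub_eq_zero.mp h2).symm
  exact ⟨LinearEquiv.ofLinearMap π i hπ (LinearMap.ext hφ0)⟩

/-- Over an Artinian ring, a presentation of the ring by free modules of ranks `b < c` is injective
on the left. -/
theorem injective_of_exact_of_rank_lt {A : Type*} [CommRing A] [Nontrivial A] [IsArtinianRing A]
    {F G N : Type*} [AddCommGroup F] [AddCommGroup G] [AddCommGroup N] [Module A F] [Module A G]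
    [Module A N] {b c : ℕ} (eF : F ≃ₗ[A] (Fin b → A)) (eG : G ≃ₗ[A] (Fin c → A)) (eN : N ≃ₗ[A] A)
    {d : F →ₗ[A] G} {ε : G →ₗ[A] N} (hε : Function.Surjective ε) (hd : Function.Exact d ε)
    (hbc : b < c) : Function.Injective d := by
  have hF : Module.length A F = b * Module.length A A := by simp [eF.length_eq]
  have hG : Module.length A G = c * Module.length A A := by simp [eG.length_eq]
  have h1 := Module.length_eq_add_of_exact (LinearMap.ker d).subtype d.rangeRestrict
    (Submodule.subtype_injective _) d.surjective_rangeRestrict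
    (by rw [LinearMap.exact_iff]; simp)
  have h2 := Module.length_eq_add_of_exact (LinearMap.range d).subtype ε
    (Submodule.subtype_injective _) hε
    (by rw [LinearMap.exact_iff, hd.linearMap_ker_eq]; simp)
  rw [hF] at h1
  rw [hG, eN.length_eq] at h2
  have hfin : Module.length A A ≠ ⊤ := Module.length_ne_top
  obtain ⟨l, hl⟩ := ENat.ne_top_iff_exists.mp hfin
  rw [← hl] at h1 h2
  have hk : Module.length A (LinearMap.ker d) ≠ ⊤ := by
    intro h
    rw [h, top_add] at h1
    exact ENat.natCast_ne_top (b * l) (mod_cast h1)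
  have hr : Module.length A (LinearMap.range d) ≠ ⊤ := by
    intro h
    rw [h, top_add] at h2
    exact ENat.natCast_ne_top (c * l) (mod_cast h2)
  obtain ⟨k, hk⟩ := ENat.ne_top_iff_exists.mp hk
  obtain ⟨r, hr⟩ := ENat.ne_top_iff_exists.mp hr
  rw [← hk, ← hr] at h1
  rw [← hr] at h2
  norm_cast at h1 h2
  -- `b * l = k + r` and `c * l = r + l` give `k + c * l = (b + 1) * l`, while `b + 1 ≤ c`.
  have hk0 : k = 0 := by nlinarith [Nat.mul_le_mul_right l (Nat.succ_le_of_lt hbc)]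
  rw [hk0, Nat.cast_zero] at hk
  rw [← LinearMap.ker_eq_bot, ← Submodule.subsingleton_iff_eq_bot]
  exact Module.length_eq_zero_iff.mp hk.symm

/-- Over a generically Gorenstein Cohen--Macaulay local ring, a presentation
`R ^ b → R ^ c → W → 0` with `b < c` of a module whose endomorphisms are the homotheties is
injective on the left. -/
theorem injective_of_isGenericallyGorenstein {R : Type u} [CommRing R] [IsCohenMacaulayLocalRing R]
    (hgen : IsGenericallyGorenstein R) {W : Type v} [AddCommGroup W] [Module R W]
    [Module.Finite R W] (hW : Function.Bijective (algebraMap R (Module.End R W))) {b c : ℕ}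
    {d : (Fin b → R) →ₗ[R] (Fin c → R)} {ε : (Fin c → R) →ₗ[R] W} (hε : Function.Surjective ε)
    (hd : Function.Exact d ε) (hbc : b < c) : Function.Injective d := by
  rw [injective_iff_map_eq_zero]
  intro z hz
  by_contra hz0
  obtain ⟨j, hj⟩ := Function.ne_iff.mp hz0
  -- Since `p` contains the annihilator of `z j`, the element `z` stays nonzero in the localization
  -- at `p`.
  obtain ⟨p, hp, hle⟩ := exists_le_isAssociatedPrime_of_isNoetherianRing R (z j) hj
  have hpp := hp.isPrime
  have hmin := IsCohenMacaulayLocalRing.mem_minimalPrimes hp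
  obtain ⟨n, hn⟩ := (hgen p hmin).finite_injectiveDimension
  have hdim := Localization.AtPrime.krullDimLE_zero hmin
  have hnoeth : IsNoetherianRing (Localization.AtPrime p) :=
    IsLocalization.isNoetherianRing p.primeCompl _ inferInstance
  have hart : IsArtinianRing (Localization.AtPrime p) :=
    isArtinianRing_iff_isNoetherianRing_krullDimLE_zero.mpr ⟨hnoeth, hdim⟩
  obtain ⟨e⟩ := nonempty_localizedModule_equiv_of_baer (baer_self_of_hasInjectiveDimensionLE hn) hW
  let B (k : ℕ) : Module.Basis (Fin k) (Localization.AtPrime p)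
      (LocalizedModule p.primeCompl (Fin k → R)) :=
    (Pi.basisFun R (Fin k)).ofIsLocalizedModule _ p.primeCompl
      (LocalizedModule.mkLinearMap p.primeCompl _)
  have hex : Function.Exact (LocalizedModule.map p.primeCompl d)
      (LocalizedModule.map p.primeCompl ε) := LocalizedModule.map_exact p.primeCompl d ε hd
  have hinj := injective_of_exact_of_rank_lt (B b).equivFun (B c).equivFun e
    (LocalizedModule.map_surjective p.primeCompl ε hε) hex hbc
  have h0 : LocalizedModule.mkLinearMap p.primeCompl _ z = 0 := by
    apply hinj
    rw [map_zero, LocalizedModule.mkLinearMap_apply, LocalizedModule.map_mk, hz]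
    exact LocalizedModule.zero_mk _
  rw [← map_zero (LocalizedModule.mkLinearMap p.primeCompl _)] at h0
  obtain ⟨s, hs⟩ := IsLocalizedModule.exists_of_eq (S := p.primeCompl) h0
  refine s.2 (hle ?_)
  rw [Submodule.mem_colon_singleton, Submodule.mem_bot]
  simpa using! congrFun hs j

/-! ### The inequality of Betti numbers -/

theorem mainTheorem10 (R : Type u) [CommRing R] [IsCohenMacaulayLocalRing R]
    (W : Type v) [AddCommGroup W] [Module R W] (hW : IsCanonicalModule R W)
    (hgen : IsGenericallyGorenstein R) (hR : ¬ IsGorensteinLocalRing R)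
    (F : MinimalFreeResolution R W) :
    F.rank 0 ≤ F.rank 1 := by
  by_contra! hlt
  have := hW.maximalCohenMacaulay.finite
  have := hW.maximalCohenMacaulay.nontrivial
  have hinj := injective_of_isGenericallyGorenstein hgen hW.bijective_homothety F.surjective_ε
    F.exact_zero hlt
  obtain ⟨n, hn, hdim⟩ := IsCohenMacaulayLocalRing.exists_localDepth_eq R
  have hb : F.rank 1 = 0 := by
    by_contra hb
    obtain ⟨rs, hlen, hm, hreg⟩ := exists_isRegular_of_localDepth_eq (M := W) (n := n)
      (WithBot.coe_injective (hW.maximalCohenMacaulay.depth_eq_dim.trans hdim))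
    obtain ⟨ts, hlen', hm', hreg'⟩ := exists_isRegular_of_localDepth_eq hn
    let e : ((Fin (F.rank 0) → R) ⧸ LinearMap.range (F.d 0)) ≃ₗ[R] W :=
      (Submodule.quotEquivOfEq _ _ F.exact_zero.linearMap_ker_eq.symm).trans
        (F.ε.quotKerEquivOfSurjective F.surjective_ε)
    obtain ⟨qs, hqs, hm'', hreg''⟩ := exists_isRegular_of_injective_of_minimal hb (F.d 0) hinj
      (F.minimal 0) hm ((e.isRegular_congr rs).mpr hreg) ts hm' hreg' (hlen'.trans hlen.symm)
    have := length_le_localDepth hm'' hreg''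
    rw [hn, hqs, hlen] at this
    norm_cast at this
    omega
  have hεinj : Function.Injective F.ε := by
    rw [injective_iff_map_eq_zero]
    intro y hy
    obtain ⟨x, rfl⟩ := (F.exact_zero y).mp hy
    have : IsEmpty (Fin (F.rank 1)) := hb ▸ Fin.isEmpty
    rw [Subsingleton.elim x 0, map_zero]
  -- `R` embeds in `Module.End R W`, which lives in universe `v`; this smallness lets injective
  -- dimension pass between modules in universes `v` and `u`.
  have : Small.{v} R := small_of_injective hW.bijective_homothety.1
  obtain ⟨n, hn⟩ := hW.finite_injectiveDimension
  have hfree : HasInjectiveDimensionLE (ModuleCat.of R (Fin (F.rank 0) → R)) n :=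
    (ModuleCat.hasInjectiveDimensionLE_iff_of_linearEquiv (M := ModuleCat.of R W)
      (N := ModuleCat.of R (Fin (F.rank 0) → R))
      (LinearEquiv.ofBijective F.ε ⟨hεinj, F.surjective_ε⟩).symm n).mp hn
  let j : Fin (F.rank 0) := ⟨0, by omega⟩
  let ret : Retract (ModuleCat.of R R) (ModuleCat.of R (Fin (F.rank 0) → R)) :=
    { i := ModuleCat.ofHom (LinearMap.single R (fun _ => R) j)
      r := ModuleCat.ofHom (LinearMap.proj j)
      retract := by
        rw [← ModuleCat.ofHom_comp, LinearMap.proj_comp_single_same]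
        rfl }
  exact hR ⟨n, ret.hasInjectiveDimensionLT (n + 1)⟩
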